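/- Let $n\ge 3$, $N=\{1,\dots,n\}$ and $V=[0,\beta]$ with $\beta>0$. An allocation rule is a map $f:V^n\to[0,1]^n$ with $\sum_{i\in N}f_i(\mathbf v)\le 1$ for all $\mathbf v\in V^n$; a mechanism $(f,\mathbf p)$ consists of an allocation rule $f$ and payment rules $p_i:V^n\to\mathbb R$, $i\in N$. A mechanism is satisfactory if it satisfies the following three conditions: - (dominant strategy incentive compatible) $v_if_i(v_i,v_{-i})-p_i(v_i,v_{-i})\ge v_if_i(v_i',v_{-i})-p_i(v_i',v_{-i})$ for all $i\in N$, all $v_i,v_i'\in V$ and all $v_{-i}\in V^{n-1}$; - (budget-balanced) $\sum_{i\in N}p_i(\mathbf v)=0$ for all $\mathbf v\in V^n$; - (symmetric) $f_i(\mathbf v)=f_j(\mathbf v)$ and $p_i(\mathbf v)=p_j(\mathbf v)$ whenever $v_i=v_j$. For a profile $\mathbf v$, let $\mathbf v[k]$ be the set of agents with the $k$-th highest valuation: $\mathbf v[1]$ is the set of agents with the highest valuation, and $\mathbf v[k]$ is the set of agents with the highest valuation among those not in $\mathbf v[1]\cup\dots\cup\mathbf v[k-1]$ (empty if there are none). Given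 $\pi_1\ge\dots\ge\pi_n$ in $[0,1]$ with $\sum_{i\in N}\pi_i\le1$, the ranking allocation rule with probabilities $(\pi_1,\dots,\pi_n)$ is the allocation rule $f$ that is symmetric ($f_i(\mathbf v)=f_j(\mathbf v)$ whenever $v_i=v_j$) and satisfies, for all $\mathbf v\in V^n$ and all $k\in N$, $$\sum_{i\in \mathbf v[1]\cup\dots\cup\mathbf v[k]}f_i(\mathbf v)=\sum_{j=1}^{L_k}\pi_j,\qquad L_k=\bigl|\mathbf v[1]\cup\dots\cup\mathbf v[k]\bigr|.$$ Let $$\ell\in\arg\min_{2\le i\le n-1,\ i\text{ even}}\ \frac{i-1}{\binom{n-2}{i-1}+i},$$ and let $f$ be the ranking allocation rule with probabilities $$\pi_1^*=1-\frac{\ell-1}{\binom{n-2}{\ell-1}+\ell},\qquad \pi_i^*=\frac{1}{\binom{n-2}{\ell-1}+\ell}\ \ (2\le i\le \ell),\qquad \pi_i^*=0\ \ (i>\ell).$$ Then every satisfactory mechanism $(f,\mathbf p)$ with this allocation rule $f$ is ex-post individually rational, that is, $$v_if_i(\mathbf v)-p_i(\mathbf v)\ge 0\qquad\text{for all } i\in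 N\text{ and all }\mathbf v\in V^n.$$ -/

import Mathlib

noncomputable section

/-- Valuation profiles `v = (v_1, …, v_n)`: every agent's valuation lies in `V = [0, β]`. -/
abbrev ValProfile (n : ℕ) (β : ℝ) : Type := Fin n → Set.Icc (0 : ℝ) β

/-- An allocation rule `f : V^n → [0,1]^n` with `∑ i, f_i(v) ≤ 1` at every profile. -/
structure AllocationRule (n : ℕ) (β : ℝ) where
  /-- `prob v i` is the probability `f_i(v)` with which agent `i` gets the object at `v`. -/
  prob : ValProfile n β → Fin n → ℝ
  prob_mem : ∀ v i, prob v i ∈ Set.Icc (0 : ℝ) 1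
  sum_prob_le_one : ∀ v, ∑ i, prob v i ≤ 1

/-- A collection of payment rules: `p v i` is the payment `p_i(v)` of agent `i` at `v`. -/
abbrev PaymentRule (n : ℕ) (β : ℝ) : Type := ValProfile n β → Fin n → ℝ

/-- The net utility `v_i f_i(w) - p_i(w)` of agent `i` with valuation `x` when the reported
profile is `w`. -/
def netUtility {n : ℕ} {β : ℝ} (f : AllocationRule n β) (p : PaymentRule n β)
    (i : Fin n) (x : Set.Icc (0 : ℝ) β) (w : ValProfile n β) : ℝ :=
  (x : ℝ) * f.prob w i - p w i

/-- Dominant strategy incentive compatibility; `Function.update v i y` is `(y, v_{-i})`. -/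
def IsDSIC {n : ℕ} {β : ℝ} (f : AllocationRule n β) (p : PaymentRule n β) : Prop :=
  ∀ (i : Fin n) (v : ValProfile n β) (y : Set.Icc (0 : ℝ) β),
    netUtility f p i (v i) v ≥ netUtility f p i (v i) (Function.update v i y)

/-- Budget balance. -/
def IsBudgetBalanced {n : ℕ} {β : ℝ} (p : PaymentRule n β) : Prop :=
  ∀ v : ValProfile n β, ∑ i, p v i = 0

/-- A symmetric allocation rule: agents with equal valuations get equal probabilities. -/
def AllocationRule.IsSymmetric {n : ℕ} {β : ℝ} (f : AllocationRule n β) : Prop :=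
  ∀ (v : ValProfile n β) (i j : Fin n), v i = v j → f.prob v i = f.prob v j

/-- A symmetric mechanism: agents with equal valuations get equal probabilities and make equal
payments. -/
def IsSymmetricMechanism {n : ℕ} {β : ℝ} (f : AllocationRule n β) (p : PaymentRule n β) : Prop :=
  ∀ (v : ValProfile n β) (i j : Fin n), v i = v j → f.prob v i = f.prob v j ∧ p v i = p v j

/-- A satisfactory mechanism. -/
def IsSatisfactory {n : ℕ} {β : ℝ} (f : AllocationRule n β) (p : PaymentRule n β) : Prop :=
  IsDSIC f p ∧ IsBudgetBalanced p ∧ IsSymmetricMechanism f p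

/-- Ex-post individual rationality. -/
def IsExPostIR {n : ℕ} {β : ℝ} (f : AllocationRule n β) (p : PaymentRule n β) : Prop :=
  ∀ (i : Fin n) (v : ValProfile n β), netUtility f p i (v i) v ≥ 0

/-- The agents of `S` with the highest valuation among the agents of `S`. -/
def maximalIn {n : ℕ} {α : Type*} [LinearOrder α] (v : Fin n → α) (S : Finset (Fin n)) :
    Finset (Fin n) :=
  {i ∈ S | ∀ j ∈ S, v j ≤ v i}

/-- `topAgents v k` is `v[1] ∪ … ∪ v[k]`, where `v[k]`, the set of agents with the `k`-th highest
valuation, is recursively the set of the highest-valuation agents outside `v[1] ∪ … ∪ v[k-1]`. -/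
def topAgents {n : ℕ} {α : Type*} [LinearOrder α] (v : Fin n → α) : ℕ → Finset (Fin n)
  | 0 => ∅
  | k + 1 => topAgents v k ∪ maximalIn v (topAgents v k)ᶜ

/-- `f` is the ranking allocation rule with probabilities `π_1 ≥ … ≥ π_n` (`π_k` is `π ⟨k-1, _⟩`
here): it is symmetric, and at every profile the agents with the `k` highest valuations,
`L_k = |v[1] ∪ … ∪ v[k]|` in number, together get the object with probability
`π_1 + … + π_{L_k}`. -/
structure AllocationRule.IsRankingWith {n : ℕ} {β : ℝ} (f : AllocationRule n β)
    (π : Fin n → ℝ) : Prop where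
  symmetric : f.IsSymmetric
  mem_unit : ∀ i, π i ∈ Set.Icc (0 : ℝ) 1
  antitone : Antitone π
  sum_le_one : ∑ i, π i ≤ 1
  sum_topAgents : ∀ (v : ValProfile n β) (k : ℕ), 1 ≤ k → k ≤ n →
    ∑ i ∈ topAgents v k, f.prob v i = ∑ i : Fin n with i.val < (topAgents v k).card, π i

/-- The quantity `(i - 1) / (C(n-2, i-1) + i)`. -/
def stepObjective (n i : ℕ) : ℝ :=
  ((i : ℝ) - 1) / ((Nat.choose (n - 2) (i - 1) : ℝ) + i)

/-- The even integers `i` with `2 ≤ i ≤ n - 1`. -/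
def stepCandidates (n : ℕ) : Set ℕ := {i | 2 ≤ i ∧ i ≤ n - 1 ∧ Even i}

/-- `ℓ ∈ argmin {(i - 1) / (C(n-2, i-1) + i) : 2 ≤ i ≤ n - 1, i even}`. -/
def IsOptimalStep (n ℓ : ℕ) : Prop :=
  ℓ ∈ stepCandidates n ∧ ∀ i ∈ stepCandidates n, stepObjective n ℓ ≤ stepObjective n i

/-- The probabilities `(π*_1, …, π*_n)` (with `π*_k` at the index `k - 1`):
`π*_1 = 1 - (ℓ-1) / (C(n-2, ℓ-1) + ℓ)`, `π*_k = 1 / (C(n-2, ℓ-1) + ℓ)` for `2 ≤ k ≤ ℓ`, and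
`π*_k = 0` for `k > ℓ`. -/
def optimalProbs (n ℓ : ℕ) (i : Fin n) : ℝ :=
  if i.val = 0 then 1 - ((ℓ : ℝ) - 1) / ((Nat.choose (n - 2) (ℓ - 1) : ℝ) + ℓ)
  else if i.val < ℓ then 1 / ((Nat.choose (n - 2) (ℓ - 1) : ℝ) + ℓ)
  else 0

end

/-! By incentive compatibility, a truthful agent's utility is its utility at valuation 0 against the
same opponents plus the integral of its own winning probability (`IsDSIC.truthfulUtility_eq`). The
integral is nonnegative, so only zero types matter.

Budget balance and symmetry determine the utility of a zero type: it is `∫ H(N(t)) dt` over `[0,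
β]`, where `N(t)` counts the opponents above `t` and `H` solves a linear recurrence, namely budget
balance read at each threshold `t` (`IsSatisfactory.truthfulUtility_zero`).

For the optimal probabilities, `H` is a positive multiple of a partial sum, with at most `ℓ - 1`
terms, of the alternating series of `1 / C(n-2, k)`, `k ≥ 1` (`zeroTypeShare_recurrence`).
Optimality of `ℓ` keeps these `k` where the binomials increase (`IsOptimalStep.two_mul_le`), so the
terms shrink and the partial sums are nonnegative. -/

section

open MeasureTheory

/-- The inequalities make `u` Lipschitz, with derivative `F` wherever `F` is continuous; a monotone
`F` is discontinuous at only countably many points. -/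
theorem integral_eq_sub_of_subgradient {u F : ℝ → ℝ} {b : ℝ} (hb : 0 ≤ b) (hF : Monotone F)
    (h : ∀ x ∈ Set.Icc 0 b, ∀ y ∈ Set.Icc 0 b, (x - y) * F y ≤ u x - u y) :
    ∫ t in (0 : ℝ)..b, F t = u b - u 0 := by
  have hbd : ∀ x ∈ Set.Icc 0 b, |F x| ≤ |F 0| + |F b| := fun x hx => by
    have h1 := hF hx.1
    have h2 := hF hx.2
    rw [abs_le]
    constructor <;> linarith [neg_abs_le (F 0), le_abs_self (F b), abs_nonneg (F 0),
      abs_nonneg (F b)]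
  have hlip : LipschitzOnWith (Real.toNNReal (|F 0| + |F b|)) u (Set.Icc 0 b) := by
    refine LipschitzOnWith.of_le_add_mul _ fun x hx y hy => ?_
    rw [Real.coe_toNNReal _ (by positivity), Real.dist_eq]
    have h1 := h y hy x hx
    have h2 : -((y - x) * F x) ≤ |x - y| * |F x| := by
      rw [← abs_mul]
      calc -((y - x) * F x) = (x - y) * F x := by ring
        _ ≤ _ := le_abs_self _
    have h3 := mul_le_mul_of_nonneg_left (hbd x hx) (abs_nonneg (x - y))
    linarith
  refine integral_eq_of_hasDerivAt_off_countable_of_le u F hb hF.countable_not_continuousAt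
    hlip.continuousOn (fun x hx => ?_) (hF.intervalIntegrable)
  have hx1 := hx.1
  have hc : ContinuousAt F x := by simpa using hx.2
  rw [hasDerivAt_iff_tendsto]
  have hc' : Filter.Tendsto (fun y => |F y - F x|) (nhds x) (nhds 0) := by
    have := (hc.sub (continuousAt_const (y := F x))).abs
    simpa [ContinuousAt] using this
  refine tendsto_of_tendsto_of_tendsto_of_le_of_le' tendsto_const_nhds hc'
    (Filter.Eventually.of_forall fun y => by positivity) ?_
  filter_upwards [Ioo_mem_nhds hx1.1 hx1.2] with y hy
  have hxI := Set.Ioo_subset_Icc_self hx1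
  have hyI := Set.Ioo_subset_Icc_self hy
  -- Together these give `0 ≤ u y - u x - (y - x) * F x ≤ (y - x) * (F y - F x)`.
  have h1 := h x hxI y hyI
  have h2 := h y hyI x hxI
  simp only [Real.norm_eq_abs, smul_eq_mul]
  rcases eq_or_ne y x with rfl | hne
  · simp
  · rw [inv_mul_le_iff₀ (abs_pos.2 (sub_ne_zero.2 hne)), ← abs_mul, abs_of_nonneg (by linarith)]
    refine le_trans ?_ (le_abs_self _)
    linarith

/-- Every set of agents closed under passing to higher valuations is a union of top classes. -/
theorem exists_topAgents_eq {n : ℕ} {α : Type*} [LinearOrder α] (v : Fin n → α)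
    (S : Finset (Fin n)) (hS : ∀ i ∈ S, ∀ j, v i ≤ v j → j ∈ S) :
    ∃ k ≤ n, topAgents v k = S := by
  -- Until `S` is reached, each stage stays inside `S` and adds at least one agent, so `n` stages
  -- suffice.
  have key : ∀ k : ℕ, (∃ k' ≤ k, topAgents v k' = S) ∨
      (topAgents v k ⊆ S ∧ k ≤ (topAgents v k).card) := by
    intro k
    induction k with
    | zero => exact Or.inr ⟨by simp [topAgents], by simp⟩
    | succ k ih =>
      rcases ih with ⟨k', hk', h⟩ | ⟨hsub, hcard⟩
      · exact Or.inl ⟨k', by omega, h⟩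
      · by_cases heq : topAgents v k = S
        · exact Or.inl ⟨k, by omega, heq⟩
        · right
          obtain ⟨s, hsS, hsT⟩ := Finset.exists_of_ssubset (lt_of_le_of_ne hsub heq)
          have hdisj : Disjoint (topAgents v k) (maximalIn v (topAgents v k)ᶜ) := by
            rw [Finset.disjoint_left]
            intro a ha hb
            simp only [maximalIn, Finset.mem_filter, Finset.mem_compl] at hb
            exact hb.1 ha
          have hne : (maximalIn v (topAgents v k)ᶜ).Nonempty := by
            obtain ⟨m, hm, hmax⟩ := Finset.exists_max_image (topAgents v k)ᶜ v
              ⟨s, Finset.mem_compl.2 hsT⟩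
            exact ⟨m, by simpa [maximalIn] using ⟨Finset.mem_compl.1 hm, by simpa using hmax⟩⟩
          refine ⟨?_, ?_⟩
          · simp only [topAgents]
            refine Finset.union_subset hsub fun i hi => ?_
            simp only [maximalIn, Finset.mem_filter] at hi
            exact hS s hsS i (hi.2 s (Finset.mem_compl.2 hsT))
          · simp only [topAgents]
            rw [Finset.card_union_of_disjoint hdisj]
            have := hne.card_pos
            omega
  rcases key n with h | ⟨h1, h2⟩
  · exact h
  · refine ⟨n, le_rfl, ?_⟩
    have h3 : topAgents v n = Finset.univ := by
      rw [← Finset.card_eq_iff_eq_univ, Fintype.card_fin]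
      exact le_antisymm (by simpa using Finset.card_le_univ (topAgents v n)) h2
    rw [h3] at h1 ⊢
    exact (Finset.univ_subset_iff.1 h1).symm

/-! ### Integrals along superlevel sets -/

/-- The superlevel set takes finitely many values, each on an order-connected set of thresholds, so
the integrand is a step function. -/
theorem intervalIntegrable_superlevel {n : ℕ} (w : Fin n → ℝ) (F : Finset (Fin n) → ℝ)
    (a b : ℝ) : IntervalIntegrable (fun t => F {k | t < w k}) volume a b := by
  have h : (fun t : ℝ => F {k | t < w k}) = fun t => ∑ S : Finset (Fin n),
      Set.indicator {s : ℝ | ({k | s < w k} : Finset (Fin n)) = S} (fun _ => F S) t := by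
    funext t
    simp [Set.indicator_apply]
  rw [h]
  have := IntervalIntegrable.sum (μ := volume) (a := a) (b := b) (Finset.univ : Finset (Finset (Fin n)))
    (f := fun S => Set.indicator {s : ℝ | ({k | s < w k} : Finset (Fin n)) = S} (fun _ => F S)) ?_
  · simpa [Finset.sum_fn] using this
  intro S _
  have hm : MeasurableSet {s : ℝ | ({k | s < w k} : Finset (Fin n)) = S} := by
    refine Set.OrdConnected.measurableSet ⟨fun x hx y hy z hz => ?_⟩
    simp only [Set.mem_ofPred_eq] at *
    ext k
    constructor
    · intro hk
      rw [← hx]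
      simp only [Finset.mem_filter, Finset.mem_univ, true_and] at hk ⊢
      exact hz.1.trans_lt hk
    · intro hk
      rw [← hy] at hk
      simp only [Finset.mem_filter, Finset.mem_univ, true_and] at hk ⊢
      exact hz.2.trans_lt hk
  rw [intervalIntegrable_iff]
  exact ((integrableOn_const (by simp)).indicator hm)

theorem integral_ite_lt {a β : ℝ} (ha : a ∈ Set.Icc 0 β) (g : ℝ → ℝ) :
    ∫ t in (0 : ℝ)..β, (if t < a then g t else 0) = ∫ t in (0 : ℝ)..a, g t := by
  rw [intervalIntegral.integral_of_le (ha.1.trans ha.2), intervalIntegral.integral_of_le ha.1]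
  rw [integral_Ioc_eq_integral_Ioo (x := 0) (y := a)]
  have : (fun t => if t < a then g t else 0) = Set.indicator (Set.Iio a) g := by
    funext t; simp [Set.indicator_apply]
  rw [this, setIntegral_indicator measurableSet_Iio]
  congr 2
  ext t
  simp only [Set.mem_inter_iff, Set.mem_Ioc, Set.mem_Iio, Set.mem_Ioo]
  constructor
  · exact fun h => ⟨h.1.1, h.2⟩
  · exact fun h => ⟨⟨h.1, h.2.le.trans ha.2⟩, h.2⟩

/-! ### Alternating sums of reciprocal binomial coefficients -/

/-- The alternating sum of reciprocal binomial coefficients `∑_{k < m} (-1)^k / C(M, k + 1)`. -/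
noncomputable def altInvChoose (M m : ℕ) : ℝ :=
  ∑ k ∈ Finset.range m, (-1) ^ k / (Nat.choose M (k + 1) : ℝ)

theorem altInvChoose_succ (M m : ℕ) :
    altInvChoose M (m + 1) = altInvChoose M m + (-1) ^ m / (Nat.choose M (m + 1) : ℝ) :=
  Finset.sum_range_succ _ _

theorem altInvChoose_recurrence (M m : ℕ) (hm : m < M) :
    ((M : ℝ) - m) * altInvChoose M (m + 1) + (m + 2) * altInvChoose M m = 1 := by
  induction m with
  | zero =>
    have : (M : ℝ) ≠ 0 := by exact_mod_cast (by omega : M ≠ 0)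
    simp [altInvChoose, this]
  | succ m ih =>
    have ih := ih (by omega)
    have h1 : (Nat.choose M (m + 1) : ℝ) ≠ 0 := by
      exact_mod_cast (Nat.choose_pos (by omega)).ne'
    have h2 : (Nat.choose M (m + 1 + 1) : ℝ) ≠ 0 := by
      exact_mod_cast (Nat.choose_pos (by omega)).ne'
    have h3 : (Nat.choose M (m + 1 + 1) : ℝ) * (m + 2) = Nat.choose M (m + 1) * (M - m - 1) := by
      have := Nat.choose_succ_right_eq M (m + 1)
      have h4 : ((M - (m + 1) : ℕ) : ℝ) = M - m - 1 := by
        rw [Nat.cast_sub (by omega)]; push_cast; ring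
      rw [← h4]
      exact_mod_cast this
    -- The terms added in passing from `m` to `m + 1` cancel, by the ratio of consecutive binomials.
    have h5 : ((M : ℝ) - m - 1) * ((-1) ^ (m + 1) / (Nat.choose M (m + 1 + 1) : ℝ)) +
        (m + 2) * ((-1) ^ m / (Nat.choose M (m + 1) : ℝ)) = 0 := by
      rw [pow_succ]
      field_simp
      linear_combination (-1) ^ m * h3
    have e1 := altInvChoose_succ M m
    have e2 := altInvChoose_succ M (m + 1)
    push_cast
    rw [e2]
    rw [e1] at ih ⊢
    linear_combination ih + h5

/-- Up to index `K` the reciprocals decrease. An odd partial sum is at least its last term, which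
pays for the next subtraction. -/
theorem altInvChoose_nonneg (M K : ℕ) (hK : 2 * K ≤ M + 1) (m : ℕ) (hm : m ≤ K) :
    0 ≤ altInvChoose M m := by
  have hdec : ∀ m, m + 1 < K → (Nat.choose M (m + 1 + 1) : ℝ)⁻¹ ≤ (Nat.choose M (m + 1) : ℝ)⁻¹ := by
    intro m hm
    have hp : 0 < Nat.choose M (m + 1) := Nat.choose_pos (by omega)
    refine inv_anti₀ (by exact_mod_cast hp) ?_
    have h := Nat.choose_succ_right_eq M (m + 1)
    have : Nat.choose M (m + 1) ≤ Nat.choose M (m + 1 + 1) := by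
      refine Nat.le_of_mul_le_mul_right (c := m + 1 + 1) ?_ (by omega)
      rw [h]
      exact Nat.mul_le_mul_left _ (by omega)
    exact_mod_cast this
  have hodd : ∀ j, 0 ≤ altInvChoose M (2 * j) →
      (Nat.choose M (2 * j + 1) : ℝ)⁻¹ ≤ altInvChoose M (2 * j + 1) := by
    intro j h
    rw [altInvChoose_succ]
    simp [pow_mul, h]
  have key : ∀ j, (2 * j ≤ K → 0 ≤ altInvChoose M (2 * j)) ∧
      (2 * j + 1 ≤ K → (Nat.choose M (2 * j + 1) : ℝ)⁻¹ ≤ altInvChoose M (2 * j + 1)) := by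
    intro j
    induction j with
    | zero =>
      have h0 : 0 ≤ altInvChoose M (2 * 0) := by simp [altInvChoose]
      exact ⟨fun _ => h0, fun _ => hodd 0 h0⟩
    | succ j ih =>
      have h0 : 2 * (j + 1) ≤ K → 0 ≤ altInvChoose M (2 * (j + 1)) := by
        intro hj
        have h1 := ih.2 (by omega)
        have h2 := hdec (2 * j) (by omega)
        rw [show 2 * (j + 1) = 2 * j + 1 + 1 by ring, altInvChoose_succ]
        have : ((-1 : ℝ)) ^ (2 * j + 1) = -1 := by simp [pow_succ, pow_mul]
        rw [this, neg_div, one_div]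
        linarith
      exact ⟨h0, fun hj => hodd (j + 1) (h0 (by omega))⟩
  rcases Nat.even_or_odd' m with ⟨j, rfl | rfl⟩
  · exact (key j).1 hm
  · exact le_trans (by positivity) ((key j).2 hm)

/-! ### The optimal step and the zero-type coefficients -/

/-- An optimal step lies in the range where the binomial coefficients `C(n-2, ·)` increase. -/
theorem IsOptimalStep.two_mul_le {n ℓ : ℕ} (h : IsOptimalStep n ℓ) : 2 * (ℓ - 1) ≤ n - 2 + 1 := by
  obtain ⟨⟨h2, hn, hev⟩, hmin⟩ := h
  by_contra! hcon
  have hl4 : 4 ≤ ℓ := by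
    obtain ⟨r, rfl⟩ := hev
    rcases Nat.lt_or_ge r 2 with hr | hr <;> omega
  -- Past the middle, `C(n-2, ℓ-1) ≤ C(n-2, ℓ-3)`, so the candidate `ℓ - 2` would have a strictly
  -- smaller objective.
  have hobj := hmin (ℓ - 2) ⟨by omega, by omega, (Nat.even_sub (by omega)).2 (by simp [hev])⟩
  obtain ⟨k, rfl⟩ : ∃ k, ℓ = k + 4 := ⟨ℓ - 4, by omega⟩
  obtain ⟨M, rfl⟩ : ∃ M, n = M + 2 := ⟨n - 2, by omega⟩
  simp only [stepObjective, show k + 4 - 2 = k + 2 by omega, show M + 2 - 2 = M by omega,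
    show k + 4 - 1 = k + 3 by omega, show k + 2 - 1 = k + 1 by omega] at hobj hcon
  have hch : Nat.choose M (k + 3) ≤ Nat.choose M (k + 1) := by
    have e1 := Nat.choose_succ_right_eq M (k + 1)
    have e2 := Nat.choose_succ_right_eq M (k + 2)
    refine Nat.le_of_mul_le_mul_right (c := (k + 3) * (k + 2)) ?_ (by positivity)
    calc Nat.choose M (k + 3) * ((k + 3) * (k + 2))
        = Nat.choose M (k + 2 + 1) * (k + 2 + 1) * (k + 2) := by ring
      _ = Nat.choose M (k + 1 + 1) * (k + 1 + 1) * (M - (k + 2)) := by rw [e2]; ring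
      _ = Nat.choose M (k + 1) * ((M - (k + 1)) * (M - (k + 2))) := by rw [e1]; ring
      _ ≤ Nat.choose M (k + 1) * ((k + 3) * (k + 2)) :=
        Nat.mul_le_mul_left _ (Nat.mul_le_mul (by omega) (by omega))
  have hch' : (Nat.choose M (k + 3) : ℝ) ≤ Nat.choose M (k + 1) := by exact_mod_cast hch
  have hpos : (0 : ℝ) ≤ Nat.choose M (k + 3) := by positivity
  rw [div_le_div_iff₀ (by positivity) (by positivity)] at hobj
  push_cast at hobj
  nlinarith [mul_nonneg (by positivity : (0 : ℝ) ≤ k) (sub_nonneg.2 hch')]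

/-- The total probability of the `m` highest ranks under the optimal probabilities. -/
theorem sum_optimalProbs {n ℓ : ℕ} (hℓ : 1 ≤ ℓ) (m : ℕ) (hm1 : 1 ≤ m) (hm : m ≤ n) :
    ∑ i : Fin n with i.val < m, optimalProbs n ℓ i =
      1 - ((ℓ : ℝ) - (min m ℓ : ℕ)) / ((Nat.choose (n - 2) (ℓ - 1) : ℝ) + ℓ) := by
  have hconv : ∑ i : Fin n with i.val < m, optimalProbs n ℓ i = ∑ k ∈ Finset.range m,
      (if k = 0 then 1 - ((ℓ : ℝ) - 1) / ((Nat.choose (n - 2) (ℓ - 1) : ℝ) + ℓ)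
      else if k < ℓ then 1 / ((Nat.choose (n - 2) (ℓ - 1) : ℝ) + ℓ) else 0) := by
    refine Finset.sum_bij (fun i _ => i.val) ?_ ?_ ?_ ?_
    · intro i hi; simpa using hi
    · intro i _ j _ hij; exact Fin.ext hij
    · intro k hk
      have hk' := Finset.mem_range.1 hk
      exact ⟨⟨k, by omega⟩, by simpa using hk', rfl⟩
    · intro i _; rfl
  rw [hconv]
  clear hconv hm
  induction m, hm1 using Nat.le_induction with
  | base => simp [hℓ]
  | succ m hm ih =>
    rw [Finset.sum_range_succ, ih, if_neg (by omega)]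
    split_ifs with h
    · rw [min_eq_left h.le, min_eq_left (by omega)]
      push_cast; ring
    · rw [min_eq_right (by omega), min_eq_right (by omega)]
      ring

/-- The sum of the coefficients of the `N` highest valuations in the utility of a zero type. -/
noncomputable def zeroTypeShare (n ℓ N : ℕ) : ℝ :=
  (Nat.choose (n - 2) (ℓ - 1) : ℝ) / ((Nat.choose (n - 2) (ℓ - 1) : ℝ) + ℓ) *
    altInvChoose (n - 2) (min N ℓ - 1)

theorem zeroTypeShare_nonneg {n ℓ : ℕ} (h : IsOptimalStep n ℓ) (N : ℕ) :
    0 ≤ zeroTypeShare n ℓ N :=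
  mul_nonneg (by positivity) (altInvChoose_nonneg _ (ℓ - 1) h.two_mul_le _ (by omega))

/-- Both sides vanish for `N ≤ 1`. For `2 ≤ N ≤ ℓ` the right side is the constant `C / (C + ℓ)` with
`C = C(n-2, ℓ-1)`, and the identity is `altInvChoose_recurrence`. For `N > ℓ` the share is constant
and the right side is 1. -/
theorem zeroTypeShare_recurrence {n ℓ : ℕ} (h : IsOptimalStep n ℓ) (P : ℕ → ℝ) (N : ℕ)
    (hP : P = fun m => ∑ i : Fin n with i.val < m, optimalProbs n ℓ i) (hN : N < n) :
    ((n : ℝ) - N) * zeroTypeShare n ℓ N + N * zeroTypeShare n ℓ (N - 1) =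
      P N - N * (P N - P (N - 1)) := by
  obtain ⟨⟨h2, hn, hev⟩, -⟩ := h
  have hPv : ∀ m, 1 ≤ m → m ≤ n → P m =
      1 - ((ℓ : ℝ) - (min m ℓ : ℕ)) / ((Nat.choose (n - 2) (ℓ - 1) : ℝ) + ℓ) := by
    intro m h1 hmn
    rw [hP]
    exact sum_optimalProbs (by omega) m h1 hmn
  have hP0 : P 0 = 0 := by simp [hP]
  obtain ⟨M, rfl⟩ : ∃ M, n = M + 2 := ⟨n - 2, by omega⟩
  obtain ⟨k, rfl⟩ : ∃ k, ℓ = k + 2 := ⟨ℓ - 2, by omega⟩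
  have hk : Even k := by simpa [Nat.even_add] using hev
  have hM : M + 2 - 2 = M := by omega
  have hk1 : k + 2 - 1 = k + 1 := by omega
  simp only [zeroTypeShare, hM, hk1] at hPv ⊢
  have hC : (0 : ℝ) < Nat.choose M (k + 1) := by exact_mod_cast Nat.choose_pos (by omega)
  set C : ℝ := (Nat.choose M (k + 1) : ℝ) with hCdef
  have hD : C + ((k + 2 : ℕ) : ℝ) ≠ 0 := by positivity
  rcases N with _ | _ | N
  · simp [hP0, altInvChoose]
  · have : min 1 (k + 2) - 1 = 0 := by omega
    simp [hP0, altInvChoose]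
  · rw [hPv _ (by omega) (by omega), hPv _ (by omega) (by omega)]
    rw [show N + 1 + 1 - 1 = N + 1 by omega]
    rcases Nat.lt_or_ge (k + 2) (N + 2) with hlt | hge
    · rw [min_eq_right (by omega), min_eq_right (by omega), hk1]
      have hrec := altInvChoose_recurrence M k (by omega)
      have hs := altInvChoose_succ M k
      -- As `ℓ` is even, the last term is `+1 / C`; this makes `n` times the constant share equal to
      -- 1.
      rw [hk.neg_one_pow, ← hCdef] at hs
      have hs' : C * altInvChoose M (k + 1) = C * altInvChoose M k + 1 := by
        rw [hs]; field_simp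
      field_simp
      push_cast at hrec ⊢
      linear_combination C * hrec + ((k : ℝ) + 2) * hs'
    · rw [min_eq_left (by omega), min_eq_left (by omega)]
      have hrec := altInvChoose_recurrence M N (by omega)
      simp only [show N + 1 + 1 - 1 = N + 1 by omega, show N + 1 - 1 = N by omega]
      field_simp
      push_cast at hrec ⊢
      linear_combination C * hrec

/-! ### Ranking rules and payoff equivalence -/

variable {n : ℕ} {β : ℝ}

/-- The utility of agent `i` at `v` when every agent reports truthfully. -/
def truthfulUtility (f : AllocationRule n β) (p : PaymentRule n β) (v : ValProfile n β)
    (i : Fin n) : ℝ :=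
  netUtility f p i (v i) v

/-- The valuation `0`. -/
def zeroVal (hβ : 0 ≤ β) : Set.Icc (0 : ℝ) β := ⟨0, le_rfl, hβ⟩

theorem AllocationRule.IsRankingWith.sum_upper {f : AllocationRule n β} {π : Fin n → ℝ}
    (hf : f.IsRankingWith π) (v : ValProfile n β) (S : Finset (Fin n))
    (hS : ∀ i ∈ S, ∀ j, v i ≤ v j → j ∈ S) :
    ∑ i ∈ S, f.prob v i = ∑ i : Fin n with i.val < S.card, π i := by
  obtain ⟨k, hk, rfl⟩ := exists_topAgents_eq v S hS
  rcases k with _ | k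
  · simp [topAgents]
  · exact hf.sum_topAgents v _ (by omega) hk

/-- Without ties at `t`, the agents above `t` form an upper set both with and without `i`; the two
totals differ by the share of `i`. -/
theorem AllocationRule.IsRankingWith.prob_update {f : AllocationRule n β} {π : Fin n → ℝ}
    (hf : f.IsRankingWith π) (v : ValProfile n β) (i : Fin n) (t : Set.Icc (0 : ℝ) β)
    (ht : ∀ k ≠ i, v k ≠ t) :
    f.prob (Function.update v i t) i =
      (∑ j : Fin n with j.val < (Finset.univ.filter fun k => k ≠ i ∧ t < v k).card + 1, π j) -
      ∑ j : Fin n with j.val < (Finset.univ.filter fun k => k ≠ i ∧ t < v k).card, π j := by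
  set S : Finset (Fin n) := Finset.univ.filter fun k => k ≠ i ∧ t < v k with hSdef
  have hiS : i ∉ S := by simp [hSdef]
  have h1 := hf.sum_upper (Function.update v i t) S (by
    intro a ha b hab
    simp only [hSdef, Finset.mem_filter, Finset.mem_univ, true_and] at ha ⊢
    rw [Function.update_of_ne ha.1] at hab
    rcases eq_or_ne b i with rfl | hb
    · rw [Function.update_self] at hab
      exact absurd hab (not_le.2 ha.2)
    · rw [Function.update_of_ne hb] at hab
      exact ⟨hb, ha.2.trans_le hab⟩)
  have h2 := hf.sum_upper (Function.update v i t) (insert i S) (by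
    have hmem : ∀ b, t ≤ Function.update v i t b → b ∈ insert i S := by
      intro b hb
      rcases eq_or_ne b i with rfl | hbi
      · exact Finset.mem_insert_self _ _
      · rw [Function.update_of_ne hbi] at hb
        refine Finset.mem_insert_of_mem ?_
        simpa [hSdef, hbi] using lt_of_le_of_ne hb (ht b hbi).symm
    intro a ha b hab
    refine hmem b (le_trans ?_ hab)
    rcases Finset.mem_insert.1 ha with rfl | ha
    · simp
    · simp only [hSdef, Finset.mem_filter, Finset.mem_univ, true_and] at ha
      rw [Function.update_of_ne ha.1]
      exact ha.2.le)
  rw [Finset.sum_insert hiS, Finset.card_insert_of_notMem hiS] at h2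
  linarith

theorem IsDSIC.subgradient {f : AllocationRule n β} {p : PaymentRule n β} (h : IsDSIC f p)
    (v : ValProfile n β) (i : Fin n) (x y : Set.Icc (0 : ℝ) β) :
    ((x : ℝ) - y) * f.prob (Function.update v i y) i ≤
      truthfulUtility f p (Function.update v i x) i -
        truthfulUtility f p (Function.update v i y) i := by
  have := h i (Function.update v i x) y
  simp only [truthfulUtility, netUtility, Function.update_self, Function.update_idem] at this ⊢
  linarith

theorem IsDSIC.prob_monotone {f : AllocationRule n β} {p : PaymentRule n β} (h : IsDSIC f p)
    (v : ValProfile n β) (i : Fin n) : Monotone fun x => f.prob (Function.update v i x) i := by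
  intro x y hxy
  rcases hxy.eq_or_lt with rfl | hlt
  · exact le_rfl
  have h1 := h.subgradient v i x y
  have h2 := h.subgradient v i y x
  have h3 : (x : ℝ) < y := hlt
  by_contra! hcon
  nlinarith

/-- The payoff equivalence formula. -/
theorem IsDSIC.truthfulUtility_eq {f : AllocationRule n β} {p : PaymentRule n β}
    (h : IsDSIC f p) (hβ : 0 ≤ β) (v : ValProfile n β) (i : Fin n) :
    truthfulUtility f p v i = truthfulUtility f p (Function.update v i (zeroVal hβ)) i +
      ∫ t in (0 : ℝ)..(v i : ℝ), f.prob (Function.update v i (Set.projIcc 0 β hβ t)) i := by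
  have key := integral_eq_sub_of_subgradient (b := (v i : ℝ))
    (F := fun t => f.prob (Function.update v i (Set.projIcc 0 β hβ t)) i)
    (u := fun t => truthfulUtility f p (Function.update v i (Set.projIcc 0 β hβ t)) i)
    (v i).2.1 ((h.prob_monotone v i).comp (Set.monotone_projIcc hβ)) (by
      intro x hx y hy
      have := h.subgradient v i (Set.projIcc 0 β hβ x) (Set.projIcc 0 β hβ y)
      have hx' : x ∈ Set.Icc 0 β := ⟨hx.1, hx.2.trans (v i).2.2⟩
      have hy' : y ∈ Set.Icc 0 β := ⟨hy.1, hy.2.trans (v i).2.2⟩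
      rw [Set.projIcc_of_mem hβ hx', Set.projIcc_of_mem hβ hy'] at this ⊢
      exact this)
  simp only [Set.projIcc_val, Function.update_eq_self] at key
  rw [Set.projIcc_of_mem hβ (⟨le_rfl, hβ⟩ : (0 : ℝ) ∈ Set.Icc 0 β)] at key
  rw [key]
  simp [zeroVal]

/-- The agents other than `i` with valuation above `t`. -/
noncomputable def othersAbove (v : ValProfile n β) (i : Fin n) (t : ℝ) : Finset (Fin n) :=
  Finset.univ.filter fun k => k ≠ i ∧ t < v k

theorem othersAbove_eq_erase (v : ValProfile n β) (i : Fin n) (t : ℝ) :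
    othersAbove v i t = (Finset.univ.filter fun k => t < (v k : ℝ)).erase i := by
  ext k
  simp [othersAbove]

theorem othersAbove_update (v : ValProfile n β) (i : Fin n) (x : Set.Icc (0 : ℝ) β) (t : ℝ) :
    othersAbove (Function.update v i x) i t = othersAbove v i t := by
  ext k
  simp only [othersAbove, Finset.mem_filter, Finset.mem_univ, true_and]
  refine and_congr_right fun hk => ?_
  rw [Function.update_of_ne hk]

theorem card_othersAbove_eq (v : ValProfile n β) {i j : Fin n} (h : v i = v j) (t : ℝ) :
    (othersAbove v i t).card = (othersAbove v j t).card := by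
  simp [othersAbove_eq_erase, Finset.card_erase_eq_ite, h]

theorem intervalIntegrable_othersAbove (v : ValProfile n β) (i : Fin n) (F : ℕ → ℝ) (a b : ℝ) :
    IntervalIntegrable (fun t => F (othersAbove v i t).card) volume a b := by
  simp only [othersAbove_eq_erase]
  exact intervalIntegrable_superlevel (fun k => (v k : ℝ)) (fun S => F (S.erase i).card) a b

theorem AllocationRule.IsRankingWith.integral_prob {f : AllocationRule n β} {π : Fin n → ℝ}
    (hf : f.IsRankingWith π) (hβ : 0 ≤ β) (P : ℕ → ℝ)
    (hP : P = fun m => ∑ i : Fin n with i.val < m, π i) (v : ValProfile n β) (i : Fin n) :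
    ∫ t in (0 : ℝ)..(v i : ℝ), f.prob (Function.update v i (Set.projIcc 0 β hβ t)) i =
      ∫ t in (0 : ℝ)..(v i : ℝ),
        (P ((othersAbove v i t).card + 1) - P (othersAbove v i t).card) := by
  refine intervalIntegral.integral_congr_ae ?_
  -- Ties occur at finitely many `t`, a null set.
  have hfin : (Set.range fun k => (v k : ℝ)).Finite := Set.finite_range _
  filter_upwards [hfin.countable.ae_notMem volume] with t ht htI
  rw [Set.uIoc_of_le (v i).2.1] at htI
  have htβ : t ∈ Set.Icc 0 β := ⟨htI.1.le, htI.2.trans (v i).2.2⟩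
  rw [Set.projIcc_of_mem hβ htβ, hf.prob_update v i ⟨t, htβ⟩, hP]
  · rfl
  · intro k _ hk
    exact ht ⟨k, by simp [hk]⟩

/-! ### Utilities of the zero types -/

/-- If `H` solves the recurrence that budget balance imposes on the utilities of the zero types,
then these utilities are the integrals of `H` along the superlevel sets of the valuations. -/
theorem IsSatisfactory.truthfulUtility_zero {f : AllocationRule n β} {p : PaymentRule n β}
    (hp : IsSatisfactory f p) {π : Fin n → ℝ} (hf : f.IsRankingWith π) (hβ : 0 ≤ β)
    (P H : ℕ → ℝ) (hP : P = fun m => ∑ i : Fin n with i.val < m, π i)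
    (hH : ∀ N < n, ((n : ℝ) - N) * H N + N * H (N - 1) = P N - N * (P N - P (N - 1)))
    (v : ValProfile n β) (i : Fin n) :
    truthfulUtility f p (Function.update v i (zeroVal hβ)) i =
      ∫ t in (0 : ℝ)..β, H (othersAbove v i t).card := by
  obtain ⟨hIC, hBB, hsym⟩ := hp
  set g : ValProfile n β → Fin n → ℝ :=
    fun v i => truthfulUtility f p (Function.update v i (zeroVal hβ)) i with hg
  set h : ValProfile n β → Fin n → ℝ :=
    fun v i => ∫ t in (0 : ℝ)..β, H (othersAbove v i t).card with hh
  have hU : ∀ v i, truthfulUtility f p v i = g v i + ∫ t in (0 : ℝ)..(v i : ℝ),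
      (P ((othersAbove v i t).card + 1) - P (othersAbove v i t).card) := by
    intro v i
    rw [hIC.truthfulUtility_eq hβ, hf.integral_prob hβ P hP]
  have hgsymm : ∀ v i j, v i = v j → g v i - h v i = g v j - h v j := by
    intro v i j hij
    have h1 : truthfulUtility f p v i = truthfulUtility f p v j := by
      simp only [truthfulUtility, netUtility, (hsym v i j hij).1, (hsym v i j hij).2, hij]
    rw [hU v i, hU v j] at h1
    simp only [hh, card_othersAbove_eq v hij, hij] at h1 ⊢
    linarith
  -- Writing `v_j f_j` as an integral over thresholds turns budget balance into an identity of
  -- integrands, which is the recurrence for `H` at `N = |A t|`. An agent at 0 ensures `N < n`.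
  have hsum : ∀ v : ValProfile n β, (∃ i, v i = zeroVal hβ) → ∑ j, (g v j - h v j) = 0 := by
    intro v ⟨i₀, hi₀⟩
    set A : ℝ → Finset (Fin n) := fun t => Finset.univ.filter fun k => t < (v k : ℝ) with hA
    have h1 : ∑ j, g v j = (∑ j, (v j : ℝ) * f.prob v j) - ∑ j, ∫ t in (0 : ℝ)..(v j : ℝ),
        (P ((othersAbove v j t).card + 1) - P (othersAbove v j t).card) := by
      have h2 : ∑ j, truthfulUtility f p v j = ∑ j, (v j : ℝ) * f.prob v j := by
        simp only [truthfulUtility, netUtility, Finset.sum_sub_distrib, hBB v, sub_zero]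
      rw [← h2, eq_sub_iff_add_eq, ← Finset.sum_add_distrib]
      exact Finset.sum_congr rfl fun j _ => (hU v j).symm
    have h2 : ∀ j, (v j : ℝ) * f.prob v j =
        ∫ t in (0 : ℝ)..β, (if t < (v j : ℝ) then f.prob v j else 0) := by
      intro j
      rw [integral_ite_lt (v j).2 (fun _ => f.prob v j)]
      simp
    have h3 : ∀ j, ∫ t in (0 : ℝ)..(v j : ℝ),
        (P ((othersAbove v j t).card + 1) - P (othersAbove v j t).card) =
        ∫ t in (0 : ℝ)..β, (if t < (v j : ℝ) then
          (P ((othersAbove v j t).card + 1) - P (othersAbove v j t).card) else 0) :=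
      fun j => (integral_ite_lt (v j).2 _).symm
    have i2 : ∀ j, IntervalIntegrable (fun t => if t < (v j : ℝ) then f.prob v j else 0)
        volume 0 β := by
      intro j
      have := intervalIntegrable_superlevel (fun k => (v k : ℝ))
        (fun S => if j ∈ S then f.prob v j else 0) 0 β
      simpa using this
    have i3 : ∀ j, IntervalIntegrable (fun t => if t < (v j : ℝ) then
          (P ((othersAbove v j t).card + 1) - P (othersAbove v j t).card) else 0)
        volume 0 β := by
      intro j
      have := intervalIntegrable_superlevel (fun k => (v k : ℝ))
        (fun S => if j ∈ S then P ((S.erase j).card + 1) - P (S.erase j).card else 0) 0 β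
      simpa [othersAbove_eq_erase] using this
    have i4 : ∀ j, IntervalIntegrable (fun t => H (othersAbove v j t).card) volume 0 β :=
      fun j => intervalIntegrable_othersAbove v j H 0 β
    rw [Finset.sum_sub_distrib, h1]
    simp only [h2, h3, hh]
    rw [← intervalIntegral.integral_finsetSum fun j _ => i2 j,
      ← intervalIntegral.integral_finsetSum fun j _ => i3 j,
      ← intervalIntegral.integral_finsetSum fun j _ => i4 j, sub_sub,
      ← intervalIntegral.integral_add, sub_eq_zero]
    · refine intervalIntegral.integral_congr fun t ht => ?_
      rw [Set.uIcc_of_le hβ] at ht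
      have hA0 : i₀ ∉ A t := by simp [hA, hi₀, zeroVal, ht.1]
      have hcard : (A t).card < n := by
        simpa using Finset.card_lt_univ_of_notMem hA0
      have e1 : ∑ j, (if t < (v j : ℝ) then f.prob v j else 0) = P (A t).card := by
        rw [← Finset.sum_filter, hP]
        refine hf.sum_upper v (A t) fun a ha b hab => ?_
        simp only [hA, Finset.mem_filter, Finset.mem_univ, true_and] at ha ⊢
        exact ha.trans_le hab
      have e2 : ∑ j, (if t < (v j : ℝ) then
          (P ((othersAbove v j t).card + 1) - P (othersAbove v j t).card) else 0) =
          (A t).card * (P (A t).card - P ((A t).card - 1)) := by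
        rw [← Finset.sum_filter, ← nsmul_eq_mul]
        refine Finset.sum_eq_card_nsmul fun j hj => ?_
        change j ∈ A t at hj
        rw [othersAbove_eq_erase, Finset.card_erase_of_mem hj,
          Nat.sub_add_cancel (Finset.card_pos.2 ⟨j, hj⟩)]
      have e3 : ∑ j, H (othersAbove v j t).card =
          ((n : ℝ) - (A t).card) * H (A t).card + (A t).card * H ((A t).card - 1) := by
        rw [← Finset.sum_add_sum_compl (A t), add_comm]
        congr 1
        · rw [Finset.sum_eq_card_nsmul (b := H (A t).card), nsmul_eq_mul, Finset.card_compl,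
            Fintype.card_fin, Nat.cast_sub hcard.le]
          intro j hj
          rw [othersAbove_eq_erase, Finset.erase_eq_of_notMem (Finset.mem_compl.1 hj)]
        · rw [Finset.sum_eq_card_nsmul (b := H ((A t).card - 1)), nsmul_eq_mul]
          intro j hj
          rw [othersAbove_eq_erase, Finset.card_erase_of_mem hj]
      simp only [e1, e2, e3, hH _ hcard]
      ring
    · simpa only [Finset.sum_fn] using
        IntervalIntegrable.sum (μ := volume) Finset.univ fun j _ => i3 j
    · simpa only [Finset.sum_fn] using
        IntervalIntegrable.sum (μ := volume) Finset.univ fun j _ => i4 j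
  have hloc : ∀ v i x, g (Function.update v i x) i - h (Function.update v i x) i =
      g v i - h v i := by
    intro v i x
    simp only [hg, hh, Function.update_idem, othersAbove_update]
  -- Induction on the number of nonzero valuations. The difference `g - h` of an agent ignores its
  -- own valuation, so for a nonzero agent that valuation can be lowered to 0 and the induction
  -- hypothesis applies. The zero agents share one value by symmetry, and `hsum` makes it 0.
  have main : ∀ (m : ℕ) (v : ValProfile n β) (i : Fin n), v i = zeroVal hβ →
      (Finset.univ.filter fun k => v k ≠ zeroVal hβ).card = m → g v i - h v i = 0 := by
    intro m
    induction m with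
    | zero =>
      intro v i hi hm
      have hz : ∀ j, v j = zeroVal hβ := by simpa [Finset.filter_eq_empty_iff] using hm
      have hs := hsum v ⟨i, hi⟩
      rw [Finset.sum_eq_card_nsmul (b := g v i - h v i)
        (fun j _ => hgsymm v j i ((hz j).trans hi.symm))] at hs
      simpa [i.pos.ne'] using hs
    | succ m ih =>
      intro v i hi hm
      have hs := hsum v ⟨i, hi⟩
      have hpos : ∀ j, v j ≠ zeroVal hβ → g v j - h v j = 0 := by
        intro j hj
        rw [← hloc v j (zeroVal hβ)]
        refine ih _ j (by simp) ?_
        have : (Finset.univ.filter fun k => Function.update v j (zeroVal hβ) k ≠ zeroVal hβ) =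
            (Finset.univ.filter fun k => v k ≠ zeroVal hβ).erase j := by
          ext k
          rcases eq_or_ne k j with rfl | hk
          · simp
          · simp [hk]
        rw [this, Finset.card_erase_of_mem (by simpa using hj), hm]
        simp
      rw [← Finset.sum_filter_add_sum_filter_not _ (fun k => v k = zeroVal hβ),
        Finset.sum_eq_zero (s := Finset.univ.filter fun k => ¬ v k = zeroVal hβ)
          (fun j hj => hpos j (by simpa using hj)), add_zero,
        Finset.sum_eq_card_nsmul (b := g v i - h v i)
        (fun j hj => hgsymm v j i ((by simpa using hj : v j = zeroVal hβ).trans hi.symm)),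
        nsmul_eq_mul] at hs
      refine (mul_eq_zero.1 hs).resolve_left ?_
      exact_mod_cast (Finset.card_pos.2 ⟨i, by simpa using hi⟩).ne'
  have := main _ (Function.update v i (zeroVal hβ)) i (by simp) rfl
  rw [hloc] at this
  exact sub_eq_zero.1 this

end

theorem mainTheorem10 (n : ℕ) (hn : 3 ≤ n) (β : ℝ) (hβ : 0 < β)
    (ℓ : ℕ) (hℓ : IsOptimalStep n ℓ)
    (f : AllocationRule n β) (hf : f.IsRankingWith (optimalProbs n ℓ))
    (p : PaymentRule n β) (hp : IsSatisfactory f p) :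
    IsExPostIR f p := by
  intro i v
  change 0 ≤ truthfulUtility f p v i
  rw [hp.1.truthfulUtility_eq hβ.le,
    hp.truthfulUtility_zero hf hβ.le _ (zeroTypeShare n ℓ) rfl
      (fun N hN => zeroTypeShare_recurrence hℓ _ N rfl hN)]
  exact add_nonneg
    (intervalIntegral.integral_nonneg hβ.le fun t _ => zeroTypeShare_nonneg hℓ _)
    (intervalIntegral.integral_nonneg (v i).2.1 fun t _ => (f.prob_mem _ _).1)
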